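/- Let $a<b$ be real numbers, let $1\le p\le\infty$, and let $L^p[a,b]$ be the Banach space of (classes of) real-valued $p$-integrable functions on $[a,b]$ with respect to Lebesgue measure (essentially bounded functions if $p=\infty$). Let $\mathcal B(L^p[a,b])$ be the space of bounded linear operators from $L^p[a,b]$ to itself, with the operator norm topology. Let $h\in\mathcal C^1[a,b]$ satisfy $h'(t)>0$ for all $t\in[a,b]$. Then there is exactly one family $(J^\alpha)_{\alpha>0}$ in $\mathcal B(L^p[a,b])$ such that 1. (Interpolation) for every $f\in L^p[a,b]$, $(J^1f)(t)=\int_a^t f(s)\,h'(s)\,ds$ for almost every $t\in[a,b]$; 2. (Index law) $J^\alpha\circ J^\beta=J^{\alpha+\beta}$ for all $\alpha,\beta>0$; 3. (Continuity) the map $(0,\infty)\to\mathcal B(L^p[a,b])$, $\alpha\mapsto J^\alpha$, is continuous. This family is the Riemann–Liouville fractional integral with respect to $h$: a family $(J^\alpha)_{\alpha>0}$ in $\mathcal B(L^p[a,b])$ satisfies 1–3 if and only if, for all $\alpha>0$ and $f\in L^p[a,b]$, $$(J^{\alpha}f)(t)=\int_a^t\frac{(h(t)-h(s))^{\alpha-1}}{\Gamma(\alpha)}\,f(s)\,h'(s)\,ds\qquad\text{for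 almost every }t\in[a,b],$$ where the integral converges absolutely for almost every $t\in[a,b]$. -/

import Mathlib

open MeasureTheory Set

noncomputable section

/-- Real-valued `L^p[a,b]`, for Lebesgue measure on `[a,b]`. -/
abbrev LpIcc (p : ENNReal) (a b : ℝ) : Type :=
  Lp ℝ p ((volume : Measure ℝ).restrict (Icc a b))

/-- The Stieltjes integral `t ↦ ∫_a^t f(s) h'(s) ds` with integrator `h`, where `h'` is the
derivative of `h` on `[a,b]` (one-sided at the endpoints). -/
def stieltjesIntegral (h : ℝ → ℝ) (a b : ℝ) (f : ℝ → ℝ) (t : ℝ) : ℝ :=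
  ∫ s in a..t, f s * derivWithin h (Icc a b) s

/-- The integrand `s ↦ (h(t) - h(s))^(α-1) / Γ(α) * f(s) * h'(s)` of the Riemann–Liouville
fractional integral with respect to `h`. -/
def rlIntegrand (h : ℝ → ℝ) (a b α : ℝ) (f : ℝ → ℝ) (t s : ℝ) : ℝ :=
  (h t - h s) ^ (α - 1) / Real.Gamma α * f s * derivWithin h (Icc a b) s

/-- The Riemann–Liouville fractional integral of order `α` and base point `a` of `f` with
respect to `h`, evaluated at `t`. -/
def rlIntegral (h : ℝ → ℝ) (a b α : ℝ) (f : ℝ → ℝ) (t : ℝ) : ℝ :=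
  ∫ s in a..t, rlIntegrand h a b α f t s

/-- In order one, the fractional integral with respect to `h` is the Stieltjes integral. -/
theorem rlIntegral_one (h : ℝ → ℝ) (a b : ℝ) (f : ℝ → ℝ) :
    rlIntegral h a b 1 f = stieltjesIntegral h a b f := by
  funext t
  simp [rlIntegral, rlIntegrand, stieltjesIntegral]

/-- The three conditions on a family `(J^α)_{α>0}` of bounded linear operators on `L^p[a,b]`:
interpolation of the Stieltjes integral, the index law, and continuity in `α` for the
operator norm. -/
structure IsStieltjesExtension (p : ENNReal) [Fact (1 ≤ p)] (a b : ℝ) (h : ℝ → ℝ)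
    (J : {α : ℝ // 0 < α} → (LpIcc p a b →L[ℝ] LpIcc p a b)) : Prop where
  interpolation : ∀ f : LpIcc p a b,
    ∀ᵐ t ∂((volume : Measure ℝ).restrict (Icc a b)), J 1 f t = stieltjesIntegral h a b f t
  index_law : ∀ α β : {α : ℝ // 0 < α}, (J α).comp (J β) = J (α + β)
  continuity : Continuous J

/-- The family `(J^α)_{α>0}` of bounded operators is the Riemann–Liouville fractional integral
with respect to `h`: for all `α > 0` and `f ∈ L^p[a,b]`, for almost every `t ∈ [a,b]` the defining
integral converges absolutely and its value is `(J^α f)(t)`. -/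
def IsRiemannLiouville (p : ENNReal) [Fact (1 ≤ p)] (a b : ℝ) (h : ℝ → ℝ)
    (J : {α : ℝ // 0 < α} → (LpIcc p a b →L[ℝ] LpIcc p a b)) : Prop :=
  ∀ (α : {α : ℝ // 0 < α}) (f : LpIcc p a b),
    ∀ᵐ t ∂((volume : Measure ℝ).restrict (Icc a b)),
      IntervalIntegrable (rlIntegrand h a b α f t) volume a t ∧
        J α f t = rlIntegral h a b α f t

end

/-! The substitution `x = h(t) - h(a)` identifies `L^p[a,b]` with `L^p[0,H]`, `H = h(b) - h(a)`,
since its Jacobian is bounded above and away from zero. This reduces everything to `h(t) = t` on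
`[0,H]`, where `J^1` is the integration operator `V`.

Existence: by Young's inequality `k ↦ k ⋆ ·` is bounded from `L^1[0,H]` to operators on `L^p[0,H]`.
The kernels `x^(α-1)/Γ(α)` form a convolution semigroup (Beta integral) that is continuous in `L^1`;
both properties pass to the operators.

Uniqueness: by continuity and the index law it suffices to determine the roots `T` of `V`, `T^(n+1)
= V`. Such a `T` commutes with `V`, hence with convolution by polynomials, hence with all
convolutions, so `TV` is convolution by `T1` (`mul_rlOp_one_of_commute`). Let `M` be multiplication
by `x`, a derivation of convolution, and `D = MT - TM`. Then `VD` is a convolution minus `V²T`, so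
it commutes with `T`, and so does `D` as `V` is injective. Therefore `V² = [M,V] = (n+1) T^n D`,
which yields `TV = (n+1) D`. Applied to `1` this is a first order linear equation for `T1`, with
solutions `C x^(1/(n+1))` (`exists_root_apply_one`). Two roots of the same order are thus
proportional, and the remaining real factor is `±1`; passing to the square of a root of twice the
order removes the sign. -/

noncomputable section

/-! ### Young's inequality on the line -/

/-- **Young's inequality** `‖k ⋆ f‖_p ≤ ‖k‖_1 ‖f‖_p` on the line. -/
theorem eLpNorm_convolution_le {p : ENNReal} (hp : 1 ≤ p) {k f : ℝ → ℝ}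
    (hk : Integrable k) (hf : AEStronglyMeasurable f volume) :
    eLpNorm (convolution k f (ContinuousLinearMap.mul ℝ ℝ) volume) p volume ≤
      eLpNorm k 1 volume * eLpNorm f p volume := by
  -- Against the finite measure `|k(s)| ds`, of mass `‖k‖_1`, the inequality becomes Hölder's
  -- inequality with the constant 1, followed by Tonelli.
  set m : Measure ℝ := volume.withDensity (fun s => ‖k s‖ₑ) with hm
  have hmu : m univ = eLpNorm k 1 volume := by
    rw [hm, withDensity_apply _ MeasurableSet.univ, Measure.restrict_univ, eLpNorm_one_eq_lintegral_enorm]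
  have hac : m ≪ volume := withDensity_absolutelyContinuous _ _
  have : IsFiniteMeasure m := ⟨by
    rw [hmu]; exact (memLp_one_iff_integrable.2 hk).2⟩
  have hpre : ∀ t : ℝ, MeasurePreserving (fun s : ℝ => t - s) volume volume :=
    fun t => Measure.measurePreserving_sub_left volume t
  have hmeas : ∀ t : ℝ, AEStronglyMeasurable (fun s => f (t - s)) volume := fun t =>
    hf.comp_measurePreserving (hpre t)
  have hpt : ∀ t : ℝ, ‖convolution k f (ContinuousLinearMap.mul ℝ ℝ) volume t‖ₑ ≤
      eLpNorm (fun s => f (t - s)) 1 m := by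
    intro t
    rw [eLpNorm_one_eq_lintegral_enorm, hm, lintegral_withDensity_eq_lintegral_mul₀'
      hk.aestronglyMeasurable.enorm]
    · refine (enorm_integral_le_lintegral_enorm _).trans (le_of_eq ?_)
      simp [enorm_mul]
    · exact ((hmeas t).mono_ac hac).enorm
  have hpt' : ∀ t : ℝ, ‖convolution k f (ContinuousLinearMap.mul ℝ ℝ) volume t‖ₑ ≤
      eLpNorm (fun s => f (t - s)) p m * m univ ^ (1 - 1 / p.toReal) := by
    intro t
    refine (hpt t).trans ?_
    simpa using eLpNorm_le_eLpNorm_mul_rpow_measure_univ hp ((hmeas t).mono_ac hac)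
  rcases eq_or_ne p ⊤ with rfl | hpt
  · rw [eLpNorm_exponent_top, eLpNorm_exponent_top]
    refine eLpNormEssSup_le_of_ae_enorm_bound (Filter.Eventually.of_forall fun t => (hpt' t).trans ?_)
    rw [hmu, mul_comm]
    -- `⊤.toReal = 0` and `1 / 0 = 0`, so the exponent `1 - 1 / p.toReal` is 1, as it should be.
    simp only [ENNReal.toReal_top, div_zero, sub_zero, ENNReal.rpow_one]
    gcongr
    rw [eLpNorm_exponent_top]
    refine (eLpNormEssSup_mono_measure _ hac).trans (le_of_eq ?_)
    simpa [Function.comp_def] using eLpNorm_comp_measurePreserving (p := ⊤) hf (hpre t)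
  · have hp0 : p ≠ 0 := (zero_lt_one.trans_le hp).ne'
    have hp1 : 1 ≤ p.toReal := by
      rw [← ENNReal.toReal_one]; exact ENNReal.toReal_mono hpt hp
    have hpp : 0 < p.toReal := by linarith
    rw [eLpNorm_eq_lintegral_rpow_enorm_toReal hp0 hpt (f := convolution _ _ _ _), one_div,
      ENNReal.rpow_inv_le_iff hpp]
    have h1 : ∀ t : ℝ, ‖convolution k f (ContinuousLinearMap.mul ℝ ℝ) volume t‖ₑ ^ p.toReal ≤
        m univ ^ (p.toReal - 1) * ∫⁻ s, ‖f (t - s)‖ₑ ^ p.toReal ∂m := by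
      intro t
      refine (ENNReal.rpow_le_rpow (hpt' t) hpp.le).trans (le_of_eq ?_)
      rw [ENNReal.mul_rpow_of_nonneg _ _ hpp.le, eLpNorm_eq_lintegral_rpow_enorm_toReal hp0 hpt,
        ← ENNReal.rpow_mul, ← ENNReal.rpow_mul, one_div_mul_cancel hpp.ne', ENNReal.rpow_one,
        mul_comm]
      congr 2
      field_simp
    refine (lintegral_mono h1).trans ?_
    have hprod : AEMeasurable (fun z : ℝ × ℝ => ‖f (z.1 - z.2)‖ₑ ^ p.toReal)
        (volume.prod m) := by
      have : AEStronglyMeasurable (fun z : ℝ × ℝ => f (z.1 - z.2)) (volume.prod m) := by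
        have h2 := hf.comp_quasiMeasurePreserving
          (quasiMeasurePreserving_sub (volume : Measure ℝ) (volume : Measure ℝ))
        exact h2.mono_ac (Measure.AbsolutelyContinuous.rfl.prod hac)
      exact this.enorm.pow_const _
    rw [lintegral_const_mul'' _ hprod.lintegral_prod_right', lintegral_lintegral_swap hprod]
    have h3 : ∀ s : ℝ, ∫⁻ t, ‖f (t - s)‖ₑ ^ p.toReal = eLpNorm f p volume ^ p.toReal := by
      intro s
      rw [lintegral_sub_right_eq_self (fun t => ‖f t‖ₑ ^ p.toReal) s,
        eLpNorm_eq_lintegral_rpow_enorm_toReal hp0 hpt, ← ENNReal.rpow_mul,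
        one_div_mul_cancel hpp.ne', ENNReal.rpow_one]
    simp only [h3, lintegral_const]
    rw [ENNReal.mul_rpow_of_nonneg _ _ hpp.le, hmu, mul_comm (_ ^ p.toReal) (eLpNorm k 1 volume),
      ← mul_assoc]
    gcongr
    nth_rewrite 2 [← ENNReal.rpow_one (eLpNorm k 1 volume)]
    rw [← ENNReal.rpow_add_of_nonneg _ _ (by linarith) (by linarith)]
    simp

/-! ### Truncated convolution on `[0,H]` -/

section

/-- Convolution of the restrictions of `k` and `f` to `[0,H]`. -/
def truncConv (H : ℝ) (k f : ℝ → ℝ) : ℝ → ℝ :=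
  convolution ((Icc 0 H).indicator k) ((Icc 0 H).indicator f)
    (ContinuousLinearMap.mul ℝ ℝ) volume

/-- The convolution of the restrictions of `k` and `f` to `[0,H]` converges absolutely at `t`. -/
def TruncConvExistsAt (H : ℝ) (k f : ℝ → ℝ) (t : ℝ) : Prop :=
  ConvolutionExistsAt ((Icc 0 H).indicator k) ((Icc 0 H).indicator f) t
    (ContinuousLinearMap.mul ℝ ℝ) volume

variable {H : ℝ} {p : ENNReal}

theorem truncConv_congr {k k' f f' : ℝ → ℝ} (hk : k =ᵐ[volume.restrict (Icc 0 H)] k')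
    (hf : f =ᵐ[volume.restrict (Icc 0 H)] f') : truncConv H k f = truncConv H k' f' :=
  convolution_congr _ ((ae_eq_restrict_iff_indicator_ae_eq measurableSet_Icc).1 hk)
    ((ae_eq_restrict_iff_indicator_ae_eq measurableSet_Icc).1 hf)

theorem truncConv_comm (k f : ℝ → ℝ) : truncConv H k f = truncConv H f k := by
  have h := convolution_flip (μ := (volume : Measure ℝ)) (L := ContinuousLinearMap.mul ℝ ℝ)
    (f := (Icc 0 H).indicator k) (g := (Icc 0 H).indicator f)
  rw [ContinuousLinearMap.flip_mul] at h
  exact h.symm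

theorem TruncConvExistsAt.symm {k f : ℝ → ℝ} {t : ℝ} (h : TruncConvExistsAt H k f t) :
    TruncConvExistsAt H f k t := by
  have h := (convolutionExistsAt_flip (μ := (volume : Measure ℝ))
    (L := ContinuousLinearMap.mul ℝ ℝ)).2 h
  rwa [ContinuousLinearMap.flip_mul] at h

theorem truncConvExistsAt_ae {k f : ℝ → ℝ} (hk : IntegrableOn k (Icc 0 H))
    (hf : IntegrableOn f (Icc 0 H)) : ∀ᵐ t, TruncConvExistsAt H k f t :=
  Integrable.ae_convolution_exists _ (hk.integrable_indicator measurableSet_Icc)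
    (hf.integrable_indicator measurableSet_Icc)

theorem integrable_truncConv {k f : ℝ → ℝ} (hk : IntegrableOn k (Icc 0 H))
    (hf : IntegrableOn f (Icc 0 H)) : Integrable (truncConv H k f) :=
  Integrable.integrable_convolution _ (hk.integrable_indicator measurableSet_Icc)
    (hf.integrable_indicator measurableSet_Icc)

theorem truncConv_add_right {k f g : ℝ → ℝ} {t : ℝ} (hf : TruncConvExistsAt H k f t)
    (hg : TruncConvExistsAt H k g t) :
    truncConv H k (f + g) t = truncConv H k f t + truncConv H k g t := by
  unfold truncConv
  rw [indicator_add']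
  exact hf.distrib_add hg

theorem truncConv_add_left {k l f : ℝ → ℝ} {t : ℝ} (hk : TruncConvExistsAt H k f t)
    (hl : TruncConvExistsAt H l f t) :
    truncConv H (k + l) f t = truncConv H k f t + truncConv H l f t := by
  rw [truncConv_comm, truncConv_add_right hk.symm hl.symm, truncConv_comm k, truncConv_comm l]

theorem truncConv_smul_right (c : ℝ) (k f : ℝ → ℝ) :
    truncConv H k (c • f) = c • truncConv H k f := by
  unfold truncConv
  rw [show (Icc 0 H).indicator (c • f) = c • (Icc 0 H).indicator f from
    indicator_const_smul _ c f]
  exact convolution_smul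

theorem truncConv_smul_left (c : ℝ) (k f : ℝ → ℝ) :
    truncConv H (c • k) f = c • truncConv H k f := by
  rw [truncConv_comm, truncConv_smul_right, truncConv_comm]

/-- On `[0,H]` the truncated convolution is given by an integral over `[0,t]`. -/
theorem truncConv_eq_intervalIntegral (k f : ℝ → ℝ) {t : ℝ} (ht : t ∈ Icc 0 H) :
    truncConv H k f t = ∫ s in (0 : ℝ)..t, k (t - s) * f s := by
  rw [intervalIntegral.integral_of_le ht.1, ← integral_Icc_eq_integral_Ioc,
    ← integral_indicator measurableSet_Icc]
  unfold truncConv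
  rw [convolution_mul_swap]
  congr 1
  ext s
  by_cases hs : s ∈ Icc 0 t
  · have h1 : s ∈ Icc 0 H := ⟨hs.1, hs.2.trans ht.2⟩
    have h2 : t - s ∈ Icc 0 H := ⟨by linarith [hs.2], by linarith [hs.1, ht.2]⟩
    simp [h1, h2, hs]
  · rw [indicator_of_notMem hs]
    by_cases h1 : s ∈ Icc 0 H
    · have h2 : t - s ∉ Icc 0 H := fun h => hs ⟨h1.1, by linarith [h.1]⟩
      simp [h2]
    · simp [h1]

theorem TruncConvExistsAt.intervalIntegrable {k f : ℝ → ℝ} {t : ℝ} (ht : t ∈ Icc 0 H)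
    (h : TruncConvExistsAt H k f t) :
    IntervalIntegrable (fun s => k (t - s) * f s) volume 0 t := by
  rw [intervalIntegrable_iff_integrableOn_Icc_of_le ht.1]
  have h1 := h.integrable_swap.integrableOn (s := Icc 0 t)
  refine h1.congr_fun (fun s hs => ?_) measurableSet_Icc
  have h1 : s ∈ Icc 0 H := ⟨hs.1, hs.2.trans ht.2⟩
  have h2 : t - s ∈ Icc 0 H := ⟨by linarith [hs.2], by linarith [hs.1, ht.2]⟩
  simp [h1, h2]

/-- Needed for associativity: an inner convolution may be nonzero beyond `H`, but its vanishing on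
the negative axis is enough to ignore the truncation there. -/
theorem truncConv_eq_zero_of_neg (k f : ℝ → ℝ) {t : ℝ} (ht : t < 0) : truncConv H k f t = 0 := by
  unfold truncConv
  rw [convolution_mul_swap, ← integral_zero ℝ ℝ (μ := volume)]
  congr 1
  ext s
  by_cases h1 : s ∈ Icc 0 H
  · have h2 : t - s ∉ Icc 0 H := fun h => by linarith [h.1, h1.1]
    simp [h2]
  · simp [h1]

/-- Associativity of the truncated convolution. -/
theorem truncConv_assoc {k l f : ℝ → ℝ} (hk : IntegrableOn k (Icc 0 H))
    (hl : IntegrableOn l (Icc 0 H)) (hf : IntegrableOn f (Icc 0 H)) :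
    ∀ᵐ t ∂(volume.restrict (Icc 0 H)),
      truncConv H (truncConv H k l) f t = truncConv H k (truncConv H l f) t := by
  have hk' := hk.integrable_indicator measurableSet_Icc
  have hl' := hl.integrable_indicator measurableSet_Icc
  have hf' := hf.integrable_indicator measurableSet_Icc
  have hlf := Integrable.integrable_convolution (ContinuousLinearMap.mul ℝ ℝ) hl'.norm hf'.norm
  have h1 : ∀ᵐ t, ConvolutionExistsAt (fun x => ‖(Icc 0 H).indicator k x‖)
      (convolution (fun x => ‖(Icc 0 H).indicator l x‖) (fun x => ‖(Icc 0 H).indicator f x‖)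
        (ContinuousLinearMap.mul ℝ ℝ) volume) t (ContinuousLinearMap.mul ℝ ℝ) volume :=
    Integrable.ae_convolution_exists _ hk'.norm hlf
  filter_upwards [ae_restrict_of_ae h1, ae_restrict_mem measurableSet_Icc] with t ht htI
  have h2 := convolution_assoc (L := ContinuousLinearMap.mul ℝ ℝ)
    (L₂ := ContinuousLinearMap.mul ℝ ℝ) (L₃ := ContinuousLinearMap.mul ℝ ℝ)
    (L₄ := ContinuousLinearMap.mul ℝ ℝ) (fun x y z => mul_assoc x y z)
    hk'.aestronglyMeasurable hl'.aestronglyMeasurable hf'.aestronglyMeasurable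
    (Integrable.ae_convolution_exists _ hk' hl')
    (Integrable.ae_convolution_exists _ hl'.norm hf'.norm) ht
  -- For `t, s ∈ [0,H]` one has `t - s ≤ H`, so truncating the first factor at `H` changes nothing
  -- at `t`.
  have h3 : ∀ k f : ℝ → ℝ, (∀ t < 0, k t = 0) → convolution k ((Icc 0 H).indicator f)
      (ContinuousLinearMap.mul ℝ ℝ) volume t = truncConv H k f t := by
    intro k f hk
    unfold truncConv
    rw [convolution_mul_swap, convolution_mul_swap]
    congr 1
    ext s
    by_cases hs : s ∈ Icc 0 H
    · rcases lt_or_ge (t - s) 0 with h0 | h0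
      · have : t - s ∉ Icc 0 H := fun h => by linarith [h.1]
        simp [hk _ h0, this]
      · have : t - s ∈ Icc 0 H := ⟨h0, by linarith [hs.1, htI.2]⟩
        simp [this]
    · simp [hs]
  have h4 := h3 (truncConv H k l) f (fun t ht => truncConv_eq_zero_of_neg k l ht)
  have h5 := h3 (truncConv H l f) k (fun t ht => truncConv_eq_zero_of_neg l f ht)
  have h6 := convolution_flip (μ := (volume : Measure ℝ)) (L := ContinuousLinearMap.mul ℝ ℝ)
    (f := (Icc 0 H).indicator k) (g := truncConv H l f)
  rw [ContinuousLinearMap.flip_mul] at h6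
  rw [← h4, truncConv_comm k (truncConv H l f), ← h5, h6]
  exact h2

/-- Multiplication by the variable is a derivation of the truncated convolution. -/
theorem mul_truncConv {k f : ℝ → ℝ} {t : ℝ} (h1 : TruncConvExistsAt H (fun x => x * k x) f t)
    (h2 : TruncConvExistsAt H k (fun x => x * f x) t) :
    t * truncConv H k f t =
      truncConv H (fun x => x * k x) f t + truncConv H k (fun x => x * f x) t := by
  unfold truncConv
  simp only [convolution_mul_swap]
  -- Under the integral, `t = (t - s) + s`.
  rw [← integral_const_mul, ← integral_add]
  · congr 1
    ext s
    simp only [indicator]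
    split_ifs <;> ring
  · exact h1.integrable_swap
  · exact h2.integrable_swap

end

/-! ### Convolution operators on `L^p[0,H]` and multiplication by the variable -/

section

variable {H : ℝ} {p : ENNReal}

theorem LpIcc.integrableOn [Fact (1 ≤ p)] {a b : ℝ} (f : LpIcc p a b) :
    IntegrableOn f (Icc a b) :=
  (Lp.memLp f).integrable Fact.out

theorem eLpNorm_truncConv_le [Fact (1 ≤ p)] (k : LpIcc 1 0 H) (f : LpIcc p 0 H) :
    eLpNorm (truncConv H k f) p volume ≤
      eLpNorm k 1 (volume.restrict (Icc 0 H)) * eLpNorm f p (volume.restrict (Icc 0 H)) := by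
  rw [← eLpNorm_indicator_eq_eLpNorm_restrict measurableSet_Icc,
    ← eLpNorm_indicator_eq_eLpNorm_restrict measurableSet_Icc]
  exact eLpNorm_convolution_le Fact.out ((LpIcc.integrableOn k).integrable_indicator measurableSet_Icc)
    ((LpIcc.integrableOn f).integrable_indicator measurableSet_Icc).aestronglyMeasurable

theorem memLp_truncConv [Fact (1 ≤ p)] (k : LpIcc 1 0 H) (f : LpIcc p 0 H) :
    MemLp (truncConv H k f) p (volume.restrict (Icc 0 H)) :=
  ⟨(integrable_truncConv (LpIcc.integrableOn k) (LpIcc.integrableOn f)).aestronglyMeasurable.restrict,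
    ((eLpNorm_mono_measure _ Measure.restrict_le_self).trans (eLpNorm_truncConv_le k f)).trans_lt
      (ENNReal.mul_lt_top (Lp.eLpNorm_lt_top k) (Lp.eLpNorm_lt_top f))⟩

variable (H p) in
/-- The bounded bilinear map sending a kernel `k ∈ L^1[0,H]` and `f ∈ L^p[0,H]` to their truncated
convolution. -/
def convOp [Fact (1 ≤ p)] : LpIcc 1 0 H →L[ℝ] LpIcc p 0 H →L[ℝ] LpIcc p 0 H :=
  LinearMap.mkContinuous₂
    (LinearMap.mk₂ ℝ (fun k f => (memLp_truncConv k f).toLp _)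
      (fun k l f => by
        refine Lp.ext ?_
        filter_upwards [MemLp.coeFn_toLp (memLp_truncConv (k + l) f),
          MemLp.coeFn_toLp (memLp_truncConv k f), MemLp.coeFn_toLp (memLp_truncConv l f),
          Lp.coeFn_add ((memLp_truncConv k f).toLp _) ((memLp_truncConv l f).toLp _),
          ae_restrict_of_ae (truncConvExistsAt_ae (LpIcc.integrableOn k) (LpIcc.integrableOn f)),
          ae_restrict_of_ae (truncConvExistsAt_ae (LpIcc.integrableOn l) (LpIcc.integrableOn f))]
          with t h1 h2 h3 h4 h5 h6
        rw [h1, h4, Pi.add_apply, h2, h3, truncConv_congr (Lp.coeFn_add k l) .rfl,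
          truncConv_add_left h5 h6])
      (fun c k f => by
        refine Lp.ext ?_
        filter_upwards [MemLp.coeFn_toLp (memLp_truncConv (c • k) f),
          MemLp.coeFn_toLp (memLp_truncConv k f),
          Lp.coeFn_smul c ((memLp_truncConv k f).toLp _)] with t h1 h2 h3
        rw [h1, h3, Pi.smul_apply, h2, truncConv_congr (Lp.coeFn_smul c k) .rfl,
          truncConv_smul_left, Pi.smul_apply])
      (fun k f g => by
        refine Lp.ext ?_
        filter_upwards [MemLp.coeFn_toLp (memLp_truncConv k (f + g)),
          MemLp.coeFn_toLp (memLp_truncConv k f), MemLp.coeFn_toLp (memLp_truncConv k g),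
          Lp.coeFn_add ((memLp_truncConv k f).toLp _) ((memLp_truncConv k g).toLp _),
          ae_restrict_of_ae (truncConvExistsAt_ae (LpIcc.integrableOn k) (LpIcc.integrableOn f)),
          ae_restrict_of_ae (truncConvExistsAt_ae (LpIcc.integrableOn k) (LpIcc.integrableOn g))]
          with t h1 h2 h3 h4 h5 h6
        rw [h1, h4, Pi.add_apply, h2, h3, truncConv_congr .rfl (Lp.coeFn_add f g),
          truncConv_add_right h5 h6])
      (fun c k f => by
        refine Lp.ext ?_
        filter_upwards [MemLp.coeFn_toLp (memLp_truncConv k (c • f)),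
          MemLp.coeFn_toLp (memLp_truncConv k f),
          Lp.coeFn_smul c ((memLp_truncConv k f).toLp _)] with t h1 h2 h3
        rw [h1, h3, Pi.smul_apply, h2, truncConv_congr .rfl (Lp.coeFn_smul c f),
          truncConv_smul_right, Pi.smul_apply]))
    1 (fun k f => by
      rw [one_mul, LinearMap.mk₂_apply, Lp.norm_toLp, Lp.norm_def, Lp.norm_def,
        ← ENNReal.toReal_mul]
      exact ENNReal.toReal_mono
        (ENNReal.mul_ne_top (Lp.eLpNorm_ne_top k) (Lp.eLpNorm_ne_top f))
        ((eLpNorm_mono_measure _ Measure.restrict_le_self).trans (eLpNorm_truncConv_le k f)))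

theorem coeFn_convOp [Fact (1 ≤ p)] (k : LpIcc 1 0 H) (f : LpIcc p 0 H) :
    convOp H p k f =ᵐ[volume.restrict (Icc 0 H)] truncConv H k f :=
  MemLp.coeFn_toLp (memLp_truncConv k f)

/-- The class in `L^1[a,b]` of an element of `L^p[a,b]`. -/
def LpIcc.toOne [Fact (1 ≤ p)] {a b : ℝ} (f : LpIcc p a b) : LpIcc 1 a b :=
  (memLp_one_iff_integrable.2 (LpIcc.integrableOn f)).toLp f

theorem LpIcc.coeFn_toOne [Fact (1 ≤ p)] {a b : ℝ} (f : LpIcc p a b) :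
    f.toOne =ᵐ[volume.restrict (Icc a b)] f :=
  MemLp.coeFn_toLp _

/-- On a bounded interval `L^p` lies in `L^1`, so either factor of the commutative convolution can
serve as kernel. -/
theorem convOp_toOne_comm [Fact (1 ≤ p)] (f g : LpIcc p 0 H) :
    convOp H p f.toOne g = convOp H p g.toOne f := by
  refine Lp.ext ((coeFn_convOp _ _).trans (.trans ?_ (coeFn_convOp _ _).symm))
  rw [truncConv_congr (LpIcc.coeFn_toOne f) .rfl, truncConv_congr (LpIcc.coeFn_toOne g) .rfl,
    truncConv_comm]

theorem convOp_comp [Fact (1 ≤ p)] (k l : LpIcc 1 0 H) :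
    (convOp H p k).comp (convOp H p l) = convOp H p (convOp H 1 k l) := by
  ext1 f
  refine Lp.ext ((coeFn_convOp _ _).trans (.trans ?_ (coeFn_convOp _ _).symm))
  rw [ContinuousLinearMap.coe_coe, truncConv_congr .rfl (coeFn_convOp l f),
    truncConv_congr (coeFn_convOp k l) .rfl]
  exact (truncConv_assoc (LpIcc.integrableOn k) (LpIcc.integrableOn l) (LpIcc.integrableOn f)).mono
    fun t h => h.symm

theorem memLp_mul_var [Fact (1 ≤ p)] (f : LpIcc p 0 H) :
    MemLp (fun x => x * f x) p (volume.restrict (Icc 0 H)) :=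
  MemLp.of_le_mul (c := H) (Lp.memLp f) (aestronglyMeasurable_id.mul (Lp.aestronglyMeasurable f))
    ((ae_restrict_mem measurableSet_Icc).mono fun x hx => by
      rw [norm_mul, Real.norm_of_nonneg hx.1]
      gcongr
      exact hx.2)

variable (H p) in
/-- Multiplication by the variable on `L^p[0,H]`. -/
def mulVar [Fact (1 ≤ p)] : LpIcc p 0 H →L[ℝ] LpIcc p 0 H :=
  LinearMap.mkContinuous
    { toFun := fun f => (memLp_mul_var f).toLp _
      map_add' := fun f g => by
        rw [← MemLp.toLp_add]
        refine MemLp.toLp_congr _ _ ((Lp.coeFn_add f g).mono fun x hx => ?_)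
        simp only [hx, Pi.add_apply, mul_add]
      map_smul' := fun c f => by
        rw [RingHom.id_apply, ← MemLp.toLp_const_smul]
        refine MemLp.toLp_congr _ _ ((Lp.coeFn_smul c f).mono fun x hx => ?_)
        simp only [hx, Pi.smul_apply, smul_eq_mul]
        ring }
    |H| (fun f => by
      refine Lp.norm_le_mul_norm_of_ae_le_mul ?_
      simp only [LinearMap.coe_mk, AddHom.coe_mk]
      filter_upwards [MemLp.coeFn_toLp (memLp_mul_var f), ae_restrict_mem measurableSet_Icc] with x h1 hx
      rw [h1, norm_mul, Real.norm_of_nonneg hx.1]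
      gcongr
      exact hx.2.trans (le_abs_self H))

theorem coeFn_mulVar [Fact (1 ≤ p)] (f : LpIcc p 0 H) :
    mulVar H p f =ᵐ[volume.restrict (Icc 0 H)] fun x => x * f x :=
  MemLp.coeFn_toLp (memLp_mul_var f)

/-- The commutator of multiplication by the variable with a convolution operator. -/
theorem mulVar_comp_convOp [Fact (1 ≤ p)] (k : LpIcc 1 0 H) :
    (mulVar H p).comp (convOp H p k) =
      convOp H p (mulVar H 1 k) + (convOp H p k).comp (mulVar H p) := by
  ext1 f
  refine Lp.ext ?_
  rw [add_apply]
  simp only [ContinuousLinearMap.comp_apply]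
  filter_upwards [coeFn_mulVar (convOp H p k f), coeFn_convOp k f,
    Lp.coeFn_add (convOp H p (mulVar H 1 k) f) (convOp H p k (mulVar H p f)),
    coeFn_convOp (mulVar H 1 k) f, coeFn_convOp k (mulVar H p f),
    ae_restrict_of_ae (truncConvExistsAt_ae ((LpIcc.integrableOn (mulVar H 1 k)).congr
      (coeFn_mulVar k)) (LpIcc.integrableOn f)),
    ae_restrict_of_ae (truncConvExistsAt_ae (LpIcc.integrableOn k)
      ((LpIcc.integrableOn (mulVar H p f)).congr (coeFn_mulVar f)))] with t h1 h2 h3 h4 h5 h6 h7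
  rw [h1, h2, h3, Pi.add_apply, h4, h5, truncConv_congr (coeFn_mulVar k) .rfl,
    truncConv_congr .rfl (coeFn_mulVar f), mul_truncConv h6 h7]

end

/-! ### Riemann–Liouville kernels and their operators on `L^p[0,H]` -/

section

variable {H : ℝ} {p : ENNReal}

/-- The Riemann–Liouville kernel `x ↦ x^(α-1) / Γ(α)`. -/
def rlKernel (α x : ℝ) : ℝ := x ^ (α - 1) / Real.Gamma α

theorem integrableOn_rpow_sub_one (H : ℝ) {α : ℝ} (hα : 0 < α) :
    IntegrableOn (fun x : ℝ => x ^ (α - 1)) (Icc 0 H) := by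
  rcases lt_or_ge H 0 with hH | hH
  · simp [Icc_eq_empty_of_lt hH]
  · rw [← intervalIntegrable_iff_integrableOn_Icc_of_le hH]
    exact intervalIntegral.intervalIntegrable_rpow' (by linarith)

theorem integrableOn_rlKernel (H : ℝ) {α : ℝ} (hα : 0 < α) :
    IntegrableOn (rlKernel α) (Icc 0 H) :=
  (integrableOn_rpow_sub_one H hα).div_const _

/-- The Riemann–Liouville kernels form a convolution semigroup. -/
theorem integral_rlKernel_mul_rlKernel {α β t : ℝ} (hα : 0 < α) (hβ : 0 < β) (ht : 0 < t) :
    ∫ s in (0 : ℝ)..t, rlKernel α (t - s) * rlKernel β s = rlKernel (α + β) t := by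
  have h1 := Complex.betaIntegral_scaled β α ht
  have h2 := Complex.Gamma_mul_Gamma_eq_betaIntegral (s := β) (t := α) (by simpa) (by simpa)
  have h3 : ∫ x in (0 : ℝ)..t, (x : ℂ) ^ ((β : ℂ) - 1) * ((t : ℂ) - x) ^ ((α : ℂ) - 1) =
      ((∫ x in (0 : ℝ)..t, x ^ (β - 1) * (t - x) ^ (α - 1) : ℝ) : ℂ) := by
    rw [← intervalIntegral.integral_ofReal]
    refine intervalIntegral.integral_congr fun x hx => ?_
    rw [uIcc_of_le ht.le] at hx
    rw [Complex.ofReal_mul, Complex.ofReal_cpow hx.1, Complex.ofReal_cpow (by linarith [hx.2])]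
    push_cast
    rfl
  rw [h3] at h1
  have h4 : ((Real.Gamma β * Real.Gamma α * t ^ (α + β - 1) : ℝ) : ℂ) =
      ((Real.Gamma (α + β) * ∫ x in (0 : ℝ)..t, x ^ (β - 1) * (t - x) ^ (α - 1) : ℝ) : ℂ) := by
    push_cast
    rw [h1, ← Complex.Gamma_ofReal, ← Complex.Gamma_ofReal, ← Complex.Gamma_ofReal, h2,
      Complex.ofReal_cpow ht.le]
    push_cast
    rw [add_comm (α : ℂ) β]
    ring
  have h5 := Complex.ofReal_injective h4
  have hΓα := (Real.Gamma_pos_of_pos hα).ne'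
  have hΓβ := (Real.Gamma_pos_of_pos hβ).ne'
  have hΓ := (Real.Gamma_pos_of_pos (add_pos hα hβ)).ne'
  have h6 : ∀ s, rlKernel α (t - s) * rlKernel β s =
      (Real.Gamma α * Real.Gamma β)⁻¹ * (s ^ (β - 1) * (t - s) ^ (α - 1)) := fun s => by
    simp only [rlKernel]
    field_simp
  simp only [h6]
  rw [intervalIntegral.integral_const_mul, rlKernel, inv_mul_eq_div, div_eq_div_iff
    (mul_ne_zero hΓα hΓβ) hΓ]
  linear_combination -h5

variable (H) in
/-- The Riemann–Liouville kernel as an element of `L^1[0,H]`. -/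
def rlKernelLp (α : {α : ℝ // 0 < α}) : LpIcc 1 0 H :=
  (memLp_one_iff_integrable.2 (integrableOn_rlKernel H α.2)).toLp _

theorem coeFn_rlKernelLp (α : {α : ℝ // 0 < α}) :
    rlKernelLp H α =ᵐ[volume.restrict (Icc 0 H)] rlKernel α :=
  MemLp.coeFn_toLp _

theorem ae_restrict_Icc_pos : ∀ᵐ t ∂(volume.restrict (Icc 0 H)), 0 < t := by
  have : ∀ᵐ t : ℝ, t ≠ 0 := Measure.ae_ne volume 0
  filter_upwards [ae_restrict_mem measurableSet_Icc, ae_restrict_of_ae this] with t h1 h2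
  exact lt_of_le_of_ne h1.1 h2.symm

theorem convOp_rlKernelLp (α β : {α : ℝ // 0 < α}) :
    convOp H 1 (rlKernelLp H α) (rlKernelLp H β) = rlKernelLp H (α + β) := by
  refine Lp.ext ?_
  filter_upwards [coeFn_convOp (rlKernelLp H α) (rlKernelLp H β), coeFn_rlKernelLp (H := H) (α + β),
    ae_restrict_mem measurableSet_Icc, ae_restrict_Icc_pos] with t h1 h2 ht ht0
  rw [h1, h2, truncConv_congr (coeFn_rlKernelLp α) (coeFn_rlKernelLp β),
    truncConv_eq_intervalIntegral _ _ ht, integral_rlKernel_mul_rlKernel α.2 β.2 ht0]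
  rfl

theorem continuousAt_rlKernel {x α : ℝ} (hx : 0 < x) (hα : 0 < α) :
    ContinuousAt (fun β => rlKernel β x) α := by
  unfold rlKernel
  refine ContinuousAt.div ?_ ?_ (Real.Gamma_pos_of_pos hα).ne'
  · exact (Real.continuousAt_const_rpow hx.ne').comp (by fun_prop)
  · refine (Real.differentiableAt_Gamma fun m => ?_).continuousAt
    have : (0 : ℝ) ≤ m := m.cast_nonneg
    linarith

/-- Dominated convergence in `L^1`. For `β ∈ [α/2, α+1]` the power `x^(β-1)` is at most `x^(α/2-1)`
for `x ≤ 1` and at most `x^α` for `x ≥ 1`, while `1/Γ(β)` stays below `1/Γ(α) + 1` near `α`. -/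
theorem continuous_rlKernelLp : Continuous (rlKernelLp H) := by
  rw [continuous_iff_continuousAt]
  rintro ⟨α, hα⟩
  rw [ContinuousAt, tendsto_iff_norm_sub_tendsto_zero]
  have hnorm : ∀ β : {α : ℝ // 0 < α}, ‖rlKernelLp H β - rlKernelLp H ⟨α, hα⟩‖ =
      ∫ x in Icc 0 H, ‖rlKernel β x - rlKernel α x‖ := by
    intro β
    rw [L1.norm_eq_integral_norm]
    refine integral_congr_ae ?_
    filter_upwards [Lp.coeFn_sub (rlKernelLp H β) (rlKernelLp H ⟨α, hα⟩),
      coeFn_rlKernelLp (H := H) β, coeFn_rlKernelLp (H := H) ⟨α, hα⟩] with x h1 h2 h3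
    rw [h1, Pi.sub_apply, h2, h3]
  simp only [hnorm]
  have hΓ : ContinuousAt (fun β : {α : ℝ // 0 < α} => (Real.Gamma β)⁻¹) ⟨α, hα⟩ := by
    refine ContinuousAt.inv₀ (ContinuousAt.comp (g := Real.Gamma) ?_
      continuous_subtype_val.continuousAt) (Real.Gamma_pos_of_pos hα).ne'
    refine (Real.differentiableAt_Gamma fun m => ?_).continuousAt
    have : (0 : ℝ) ≤ m := m.cast_nonneg
    simp only
    linarith
  set C : ℝ := (Real.Gamma α)⁻¹ + 1 with hC
  have hev : ∀ᶠ β : {α : ℝ // 0 < α} in nhds ⟨α, hα⟩,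
      α / 2 ≤ β ∧ (β : ℝ) ≤ α + 1 ∧ (Real.Gamma β)⁻¹ ≤ C := by
    have hv : ContinuousAt (fun β : {α : ℝ // 0 < α} => (β : ℝ)) ⟨α, hα⟩ :=
      continuous_subtype_val.continuousAt
    refine (hv.eventually_const_le (by simp only; linarith)).and
      ((hv.eventually_le_const (by simp only; linarith)).and (hΓ.eventually_le_const ?_))
    simp [hC]
  have hlim := tendsto_integral_filter_of_dominated_convergence
    (μ := volume.restrict (Icc 0 H)) (l := nhds (⟨α, hα⟩ : {α : ℝ // 0 < α}))
    (F := fun β x => ‖rlKernel β x - rlKernel α x‖) (f := fun _ => (0 : ℝ))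
    (fun x => C * (x ^ (α / 2 - 1) + x ^ (α + 1 - 1)) + ‖rlKernel α x‖)
    (Filter.Eventually.of_forall fun β => ((integrableOn_rlKernel H β.2).sub
      (integrableOn_rlKernel H hα)).aestronglyMeasurable.norm) ?_ ?_ ?_
  · simpa using hlim
  · filter_upwards [hev] with β hβ
    filter_upwards [ae_restrict_Icc_pos] with x hx
    rw [norm_norm]
    refine (norm_sub_le _ _).trans (add_le_add_left ?_ _)
    have hΓβ := Real.Gamma_pos_of_pos β.2
    rw [rlKernel, Real.norm_of_nonneg (by positivity), div_eq_inv_mul]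
    have hC0 : 0 ≤ C := (inv_pos.2 hΓβ).le.trans hβ.2.2
    refine mul_le_mul hβ.2.2 ?_ (by positivity) hC0
    rcases le_total x 1 with h1 | h1
    · have := Real.rpow_le_rpow_of_exponent_ge hx h1 (show α / 2 - 1 ≤ β - 1 by linarith)
      have h2 : 0 ≤ x ^ (α + 1 - 1) := by positivity
      linarith
    · have := Real.rpow_le_rpow_of_exponent_le h1 (show (β : ℝ) - 1 ≤ α + 1 - 1 by linarith)
      have h2 : 0 ≤ x ^ (α / 2 - 1) := by positivity
      linarith
  · exact (((integrableOn_rpow_sub_one H (by linarith)).add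
      (integrableOn_rpow_sub_one H (by linarith))).const_mul C).add
      (integrableOn_rlKernel H hα).norm
  · filter_upwards [ae_restrict_Icc_pos] with x hx
    have h1 : ContinuousAt (fun β : {α : ℝ // 0 < α} => rlKernel β x) ⟨α, hα⟩ :=
      ContinuousAt.comp (g := fun β => rlKernel β x) (continuousAt_rlKernel hx hα)
        continuous_subtype_val.continuousAt
    have h2 := (h1.sub (continuousAt_const (y := rlKernel α x))).norm
    simpa [ContinuousAt] using h2

variable (H p) in
/-- The Riemann–Liouville fractional integral operators on `L^p[0,H]`. -/
def rlOp [Fact (1 ≤ p)] (α : {α : ℝ // 0 < α}) : LpIcc p 0 H →L[ℝ] LpIcc p 0 H :=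
  convOp H p (rlKernelLp H α)

theorem rlOp_comp [Fact (1 ≤ p)] (α β : {α : ℝ // 0 < α}) :
    (rlOp H p α).comp (rlOp H p β) = rlOp H p (α + β) := by
  rw [rlOp, rlOp, convOp_comp, convOp_rlKernelLp, rlOp]

theorem continuous_rlOp [Fact (1 ≤ p)] : Continuous (rlOp H p) :=
  (convOp H p).continuous.comp continuous_rlKernelLp

theorem coeFn_rlOp [Fact (1 ≤ p)] (α : {α : ℝ // 0 < α}) (f : LpIcc p 0 H) :
    ∀ᵐ t ∂(volume.restrict (Icc 0 H)),
      IntervalIntegrable (fun s => rlKernel α (t - s) * f s) volume 0 t ∧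
        rlOp H p α f t = ∫ s in (0 : ℝ)..t, rlKernel α (t - s) * f s := by
  filter_upwards [coeFn_convOp (rlKernelLp H α) f, ae_restrict_mem measurableSet_Icc,
    ae_restrict_of_ae (truncConvExistsAt_ae (integrableOn_rlKernel H α.2)
      (LpIcc.integrableOn f))] with t h1 ht h2
  refine ⟨h2.intervalIntegrable ht, ?_⟩
  rw [rlOp, h1, truncConv_congr (coeFn_rlKernelLp α) .rfl, truncConv_eq_intervalIntegral _ _ ht]

theorem coeFn_rlOp_one [Fact (1 ≤ p)] (f : LpIcc p 0 H) :
    rlOp H p 1 f =ᵐ[volume.restrict (Icc 0 H)] fun t => ∫ s in (0 : ℝ)..t, f s := by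
  filter_upwards [coeFn_rlOp 1 f] with t ht
  rw [ht.2]
  simp [rlKernel]

end

/-! ### Operators commuting with integration -/

section

variable {H : ℝ} {p : ENNReal}

variable (H p) in
/-- The constant function `1` in `L^p[0,H]`. -/
def oneLp : LpIcc p 0 H := (memLp_const (1 : ℝ)).toLp _

theorem coeFn_oneLp : oneLp H p =ᵐ[volume.restrict (Icc 0 H)] fun _ => (1 : ℝ) :=
  MemLp.coeFn_toLp _

variable [Fact (1 ≤ p)]

/-- The primitive is continuous, so it vanishes everywhere inside the interval and has derivative
zero; by Lebesgue differentiation that derivative is `f` almost everywhere. -/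
theorem ae_eq_zero_of_intervalIntegral_eq_zero (hH : 0 < H) {f : ℝ → ℝ}
    (hf : IntegrableOn f (Icc 0 H))
    (h0 : ∀ᵐ t ∂(volume.restrict (Icc 0 H)), ∫ s in (0 : ℝ)..t, f s = 0) :
    f =ᵐ[volume.restrict (Icc 0 H)] 0 := by
  have hfi : IntervalIntegrable f volume 0 H :=
    (intervalIntegrable_iff_integrableOn_Icc_of_le hH.le).2 hf
  have hcont : ContinuousOn (fun t => ∫ s in (0 : ℝ)..t, f s) (Icc 0 H) := by
    have := intervalIntegral.continuousOn_primitive_interval (μ := volume) (f := f) (a := 0) (b := H)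
      (by rwa [uIcc_of_le hH.le])
    rwa [uIcc_of_le hH.le] at this
  have hzero : EqOn (fun t => ∫ s in (0 : ℝ)..t, f s) 0 (Ioo 0 H) := by
    refine Measure.eqOn_open_of_ae_eq (μ := volume) ?_ isOpen_Ioo (hcont.mono Ioo_subset_Icc_self)
      continuousOn_const
    exact ae_restrict_of_ae_restrict_of_subset Ioo_subset_Icc_self h0
  have hd := hfi.ae_hasDerivAt_integral
  rw [Filter.EventuallyEq, ← restrict_Ioo_eq_restrict_Icc]
  filter_upwards [ae_restrict_of_ae hd, ae_restrict_mem measurableSet_Ioo] with x hx hxI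
  have hx' := hx (by rw [uIcc_of_le hH.le]; exact Ioo_subset_Icc_self hxI) 0 (by simp [hH.le])
  have h2 : HasDerivAt (fun t => ∫ s in (0 : ℝ)..t, f s) 0 x :=
    (hasDerivAt_const x (0 : ℝ)).congr_of_eventuallyEq
      (Filter.eventuallyEq_of_mem (isOpen_Ioo.mem_nhds hxI) hzero)
  exact hx'.unique h2

theorem rlOp_one_injective (hH : 0 < H) : Function.Injective (rlOp H p 1) := by
  rw [injective_iff_map_eq_zero]
  intro f hf
  refine (Lp.eq_zero_iff_ae_eq_zero).2
    (ae_eq_zero_of_intervalIntegral_eq_zero hH (LpIcc.integrableOn f) ?_)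
  filter_upwards [coeFn_rlOp_one f, Lp.coeFn_zero ℝ p (volume.restrict (Icc 0 H))] with t h1 h2
  rw [← h1, hf, h2, Pi.zero_apply]

/-- Polynomials are dense in `L^1[0,H]`. -/
theorem dense_span_rlKernelLp :
    Dense (Submodule.span ℝ (range fun n : ℕ => rlKernelLp H ⟨n + 1, by positivity⟩) :
      Set (LpIcc 1 0 H)) := by
  set W := Submodule.span ℝ (range fun n : ℕ => rlKernelLp H ⟨n + 1, by positivity⟩) with hW
  have hmono : ∀ n : ℕ, ∀ g : LpIcc 1 0 H,
      g =ᵐ[volume.restrict (Icc 0 H)] (fun x => x ^ n) → g ∈ W := by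
    intro n g hg
    have hgW : g = Real.Gamma (n + 1) • rlKernelLp H ⟨n + 1, by positivity⟩ := by
      refine Lp.ext ?_
      filter_upwards [hg, Lp.coeFn_smul (Real.Gamma (n + 1)) (rlKernelLp H ⟨n + 1, by positivity⟩),
        coeFn_rlKernelLp (H := H) ⟨(n : ℝ) + 1, by positivity⟩] with x h1 h2 h3
      have := (Real.Gamma_pos_of_pos (show (0 : ℝ) < n + 1 by positivity)).ne'
      rw [h1, h2, Pi.smul_apply, h3, rlKernel, smul_eq_mul, mul_div_cancel₀ _ this]
      simp
    rw [hgW]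
    exact W.smul_mem _ (Submodule.subset_span ⟨n, rfl⟩)
  have hpoly : ∀ q : Polynomial ℝ, ∃ g ∈ W,
      g =ᵐ[volume.restrict (Icc 0 H)] fun x => q.eval x := by
    intro q
    induction q using Polynomial.induction_on' with
    | add q r hq hr =>
      obtain ⟨g, hg, hg'⟩ := hq
      obtain ⟨k, hk, hk'⟩ := hr
      refine ⟨g + k, W.add_mem hg hk, ?_⟩
      filter_upwards [hg', hk', Lp.coeFn_add g k] with x h1 h2 h3
      rw [h3, Pi.add_apply, h1, h2, Polynomial.eval_add]
    | monomial n c =>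
      have hi : IntegrableOn (fun x : ℝ => x ^ n) (Icc 0 H) :=
        (continuous_pow n).continuousOn.integrableOn_Icc
      set g : LpIcc 1 0 H := (memLp_one_iff_integrable.2 hi).toLp _
      have hg : g =ᵐ[volume.restrict (Icc 0 H)] (fun x => x ^ n) := MemLp.coeFn_toLp _
      refine ⟨c • g, W.smul_mem c (hmono n g hg), ?_⟩
      filter_upwards [hg, Lp.coeFn_smul c g] with x h1 h2
      rw [h2, Pi.smul_apply, h1, Polynomial.eval_monomial, smul_eq_mul]
  rw [Metric.dense_iff]
  intro f r hr
  obtain ⟨g, hg, hgm⟩ := (Lp.memLp f).exists_boundedContinuous_eLpNorm_sub_le ENNReal.one_ne_top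
    (ε := ENNReal.ofReal (r / 2)) (by simpa using hr)
  -- A uniform error `c` costs at most `|H| c` in `L^1`; the `+ 1` avoids division by zero and the
  -- last halving makes the bound strict.
  set c : ℝ := r / 2 / (|H| + 1) / 2 with hc
  have hcpos : 0 < c := by positivity
  obtain ⟨q, hq⟩ := exists_polynomial_near_of_continuousOn 0 H g g.continuous.continuousOn c hcpos
  obtain ⟨k, hkW, hk⟩ := hpoly q
  refine ⟨k, ?_, hkW⟩
  set g' : LpIcc 1 0 H := hgm.toLp _ with hg'
  have hg'e : g' =ᵐ[volume.restrict (Icc 0 H)] g := MemLp.coeFn_toLp _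
  have h1 : dist f g' ≤ r / 2 := by
    rw [Lp.dist_def]
    refine ENNReal.toReal_le_of_le_ofReal (by positivity) (le_trans (le_of_eq ?_) hg)
    exact eLpNorm_congr_ae (Filter.EventuallyEq.rfl.sub hg'e)
  have h2 : dist g' k < r / 2 := by
    rw [dist_eq_norm, L1.norm_eq_integral_norm]
    have hle : ∫ x in Icc 0 H, ‖(g' - k) x‖ ≤ ∫ x in Icc 0 H, c := by
      refine integral_mono_ae (L1.integrable_coeFn _).norm (integrable_const c) ?_
      filter_upwards [hg'e, hk, Lp.coeFn_sub g' k, ae_restrict_mem measurableSet_Icc]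
        with x h1 h2 h3 hx
      rw [h3, Pi.sub_apply, h1, h2, Real.norm_eq_abs, abs_sub_comm]
      exact (hq x hx).le
    refine hle.trans_lt ?_
    rw [setIntegral_const, smul_eq_mul, measureReal_def, Real.volume_Icc, sub_zero]
    have h3 : (ENNReal.ofReal H).toReal ≤ |H| := by
      rw [ENNReal.toReal_ofReal']
      exact max_le (le_abs_self H) (abs_nonneg H)
    calc (ENNReal.ofReal H).toReal * c ≤ |H| * c := by gcongr
      _ < (|H| + 1) * c * 2 := by nlinarith [abs_nonneg H]
      _ = r / 2 := by rw [hc]; field_simp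
  rw [Metric.mem_ball, dist_comm]
  linarith [dist_triangle f g' k]

theorem rlOp_one_pow (n : ℕ) : rlOp H p 1 ^ (n + 1) = rlOp H p ⟨n + 1, by positivity⟩ := by
  induction n with
  | zero =>
    rw [zero_add, pow_one]
    congr 1
    ext
    simp
  | succ n ih =>
    rw [pow_succ, ih]
    refine (rlOp_comp _ _).trans ?_
    congr 1
    ext
    simp

/-- An operator commuting with integration commutes with all convolution operators. -/
theorem commute_convOp {T : LpIcc p 0 H →L[ℝ] LpIcc p 0 H} (hT : Commute T (rlOp H p 1))
    (k : LpIcc 1 0 H) : Commute T (convOp H p k) := by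
  -- The kernels of order `n + 1` give the powers of `V`. Commuting with `T` is linear and closed in
  -- `k`, so it extends from their span to all of `L^1`.
  refine dense_span_rlKernelLp.induction (P := fun k => Commute T (convOp H p k)) (fun k hk => ?_)
    ?_ k
  · induction hk using Submodule.span_induction with
    | mem k hk =>
      obtain ⟨n, rfl⟩ := hk
      have := hT.pow_right (n + 1)
      rwa [rlOp_one_pow] at this
    | zero => simp
    | add k l _ _ hk hl => rw [map_add]; exact hk.add_right hl
    | smul c k _ hk => rw [map_smul]; exact hk.smul_right c
  · exact isClosed_eq (continuous_const.mul (convOp H p).continuous)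
      ((convOp H p).continuous.mul continuous_const)

theorem rlKernelLp_one : rlKernelLp H 1 = (oneLp H p).toOne := by
  refine Lp.ext ?_
  filter_upwards [coeFn_rlKernelLp (H := H) 1, LpIcc.coeFn_toOne (oneLp H p),
    coeFn_oneLp (H := H) (p := p)] with x h1 h2 h3
  rw [h1, h2, h3]
  simp [rlKernel]

theorem rlOp_one_eq (f : LpIcc p 0 H) : rlOp H p 1 f = convOp H p f.toOne (oneLp H p) := by
  rw [rlOp, rlKernelLp_one (p := p), convOp_toOne_comm]

/-- `T V f = T (f ⋆ 1) = f ⋆ T1 = T1 ⋆ f`, the middle equality because `T` commutes with convolution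
by `f`. -/
theorem mul_rlOp_one_of_commute {T : LpIcc p 0 H →L[ℝ] LpIcc p 0 H}
    (hT : Commute T (rlOp H p 1)) :
    T * rlOp H p 1 = convOp H p (T (oneLp H p)).toOne := by
  ext1 f
  have h := DFunLike.congr_fun (commute_convOp hT f.toOne).eq (oneLp H p)
  simp only [mul_apply_eq_comp] at h ⊢
  rw [rlOp_one_eq, h, convOp_toOne_comm]

/-- Multiplication by the variable applied to the kernel `1` gives the kernel of the square of
integration. -/
theorem mulVar_mul_rlOp_one :
    mulVar H p * rlOp H p 1 = rlOp H p 1 * rlOp H p 1 + rlOp H p 1 * mulVar H p := by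
  refine (mulVar_comp_convOp (rlKernelLp H 1)).trans ?_
  congr 1
  have : mulVar H 1 (rlKernelLp H 1) = rlKernelLp H (1 + 1) := by
    refine Lp.ext ?_
    filter_upwards [coeFn_mulVar (rlKernelLp H 1), coeFn_rlKernelLp (H := H) 1,
      coeFn_rlKernelLp (H := H) (1 + 1)] with x h1 h2 h3
    rw [h1, h2, h3]
    norm_num [rlKernel, one_add_one_eq_two]
  rw [this]
  exact (rlOp_comp 1 1).symm

theorem mulVar_oneLp : mulVar H p (oneLp H p) = rlOp H p 1 (oneLp H p) := by
  refine Lp.ext ?_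
  filter_upwards [coeFn_mulVar (oneLp H p), coeFn_rlOp_one (oneLp H p),
    coeFn_oneLp (H := H) (p := p), ae_restrict_mem measurableSet_Icc] with x h1 h2 h3 hx
  rw [h1, h2, h3]
  have : ∫ s in (0 : ℝ)..x, oneLp H p s = ∫ s in (0 : ℝ)..x, (1 : ℝ) := by
    refine intervalIntegral.integral_congr_ae ?_
    rw [uIoc_of_le hx.1, ← ae_restrict_iff' measurableSet_Ioc]
    exact ae_restrict_of_ae_restrict_of_subset
      (Ioc_subset_Icc_self.trans (Icc_subset_Icc_right hx.2)) coeFn_oneLp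
  rw [this]
  simp

end

/-! ### Roots of the integration operator and uniqueness on `[0,H]` -/

section

variable {H : ℝ} {p : ENNReal}

/-- The integrable solutions of `x f(x) = c ∫_0^x f` are multiples of `x ↦ x^(c-1)`. -/
theorem exists_eq_const_mul_rpow (hH : 0 < H) {f : ℝ → ℝ} (hf : IntegrableOn f (Icc 0 H)) (c : ℝ)
    (h0 : ∀ᵐ t ∂(volume.restrict (Icc 0 H)), t * f t = c * ∫ s in (0 : ℝ)..t, f s) :
    ∃ C : ℝ, f =ᵐ[volume.restrict (Icc 0 H)] fun t => C * t ^ (c - 1) := by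
  set F : ℝ → ℝ := fun t => ∫ s in (0 : ℝ)..t, f s with hF
  have hcont : ContinuousOn F (Icc 0 H) := by
    have := intervalIntegral.continuousOn_primitive_interval (μ := volume) (f := f) (a := 0) (b := H)
      (by rwa [uIcc_of_le hH.le])
    rwa [uIcc_of_le hH.le] at this
  have hae : ∀ᵐ t ∂(volume.restrict (Icc 0 H)), f t = c * F t / t := by
    filter_upwards [h0, ae_restrict_Icc_pos] with t h1 h2
    rw [← h1]
    field_simp
  -- Almost everywhere `f` equals `c F(t)/t`, which is continuous on the open interval; so `F` is
  -- differentiable at every point there, not just almost every one.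
  have hderiv : ∀ x ∈ Ioo 0 H, HasDerivAt F (c * F x / x) x := by
    intro x hx
    have hnhds : Icc 0 H ∈ nhds x := Icc_mem_nhds hx.1 hx.2
    refine intervalIntegral.integral_hasDerivAt_of_tendsto_ae_right
      ((intervalIntegrable_iff_integrableOn_Icc_of_le hx.1.le).2
        (hf.mono_set (Icc_subset_Icc_right hx.2.le)))
      ⟨Icc 0 H, hnhds, hf.aestronglyMeasurable⟩ ?_
    have hcx : ContinuousAt (fun t => c * F t / t) x :=
      ((hcont.continuousAt hnhds).const_mul c).div continuousAt_id hx.1.ne'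
    refine Filter.Tendsto.congr' ?_ (hcx.tendsto.mono_left inf_le_left)
    rw [ae_restrict_iff' measurableSet_Icc] at hae
    filter_upwards [Filter.mem_inf_of_left hnhds, Filter.mem_inf_of_right hae] with t h1 h2
    exact (h2 h1).symm
  have hderiv' : ∀ x ∈ Ioo 0 H, HasDerivAt (fun t => F t * t ^ (-c)) 0 x := by
    intro x hx
    have h1 := (hderiv x hx).mul (Real.hasDerivAt_rpow_const (p := -c) (Or.inl hx.1.ne'))
    refine h1.congr_deriv ?_
    rw [Real.rpow_sub_one hx.1.ne']
    field_simp
    ring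
  have hmid : H / 2 ∈ Ioo 0 H := ⟨by linarith, by linarith⟩
  -- `F(t) t^(-c)` is constant, hence equal to its value at the midpoint; the factor `c` comes from
  -- `f = c F / t`.
  refine ⟨c * (F (H / 2) * (H / 2) ^ (-c)), ?_⟩
  rw [Filter.EventuallyEq, ← restrict_Ioo_eq_restrict_Icc]
  filter_upwards [ae_restrict_of_ae_restrict_of_subset Ioo_subset_Icc_self hae,
    ae_restrict_mem measurableSet_Ioo] with t h1 ht
  have hconst := isOpen_Ioo.is_const_of_deriv_eq_zero isPreconnected_Ioo
    (fun x hx => (hderiv' x hx).differentiableAt.differentiableWithinAt)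
    (fun x hx => (hderiv' x hx).deriv) hmid ht
  rw [h1, hconst, Real.rpow_sub_one ht.1.ne', Real.rpow_neg ht.1.le]
  have : t ^ c ≠ 0 := (Real.rpow_pos_of_pos ht.1 c).ne'
  field_simp

theorem oneLp_ne_zero (hH : 0 < H) : oneLp H p ≠ 0 := by
  intro h
  have h1 := (Lp.eq_zero_iff_ae_eq_zero).1 h
  have h2 : ∀ᵐ _t ∂(volume.restrict (Icc 0 H)), False := by
    filter_upwards [h1, coeFn_oneLp (H := H) (p := p)] with t h1 h2
    rw [h1] at h2
    simp at h2
  rw [Filter.eventually_false_iff_eq_bot, ae_eq_bot, Measure.restrict_eq_zero, Real.volume_Icc] at h2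
  simp at h2
  linarith

variable [Fact (1 ≤ p)]

/-- Injectivity of `V` cancels on the left only, so in later uses `V` is first commuted to the left.
-/
theorem mul_left_cancel_rlOp_one (hH : 0 < H) {A B : LpIcc p 0 H →L[ℝ] LpIcc p 0 H}
    (h : rlOp H p 1 * A = rlOp H p 1 * B) : A = B := by
  ext1 f
  exact rlOp_one_injective hH (DFunLike.congr_fun h f)

/-- For a root `T` of the integration operator, `T 1` solves a first order linear equation. -/
theorem mulVar_root_apply_one (hH : 0 < H) {T : LpIcc p 0 H →L[ℝ] LpIcc p 0 H} {n : ℕ}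
    (hT : T ^ (n + 1) = rlOp H p 1) :
    ((n : ℝ) + 1) • mulVar H p (T (oneLp H p)) =
      ((n : ℝ) + 2) • rlOp H p 1 (T (oneLp H p)) := by
  set V := rlOp H p 1 with hV
  set M := mulVar H p with hM
  set D := M * T - T * M with hD
  have hTV : Commute T V := hT ▸ Commute.self_pow T (n + 1)
  have hMV : M * V = V * V + V * M := mulVar_mul_rlOp_one
  set k := (T (oneLp H p)).toOne with hk
  have hTVk : T * V = convOp H p k := mul_rlOp_one_of_commute hTV
  have hMk : M * convOp H p k = convOp H p (mulVar H 1 k) + convOp H p k * M :=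
    mulVar_comp_convOp k
  -- From `VM = MV - V²` one gets `VD = [M, TV] - V²T`, and the commutator of `M` with the
  -- convolution `TV` is again a convolution.
  have hVD : V * D = convOp H p (mulVar H 1 k) - V * V * T := by
    have h1 : convOp H p (mulVar H 1 k) = M * (T * V) - T * V * M := by
      rw [hTVk, hMk, add_sub_cancel_right]
    have h2 : V * M = M * V - V * V := by rw [hMV, add_sub_cancel_left]
    rw [h1, hD, mul_sub, ← mul_assoc, h2, ← mul_assoc V T M, hTV.eq, sub_mul, mul_assoc M V T]
    abel
  have hTVD : Commute T (V * D) := by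
    rw [hVD]
    exact (commute_convOp hTV _).sub_right ((hTV.mul_right hTV).mul_right (Commute.refl T))
  have hTD : T * D = D * T := by
    refine mul_left_cancel_rlOp_one hH ?_
    rw [← hV, ← mul_assoc, ← hTV.eq, mul_assoc, hTVD.eq, mul_assoc]
  -- Since `D` commutes with `T`, commutation with `M` differentiates powers of `T` as in the scalar
  -- case.
  have hpow : ∀ j : ℕ, M * T ^ (j + 1) = T ^ (j + 1) * M + ((j : ℝ) + 1) • (T ^ j * D) := by
    intro j
    induction j with
    | zero => simp [hD]
    | succ j ih =>
      rw [pow_succ T (j + 1), ← mul_assoc, ih, add_mul, smul_mul_assoc, mul_assoc (T ^ j), ← hTD,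
        ← mul_assoc (T ^ j), ← pow_succ, mul_assoc _ M T,
        show M * T = T * M + D by rw [hD]; abel, mul_add, ← mul_assoc]
      push_cast
      module
  have h1 : V * V = ((n : ℝ) + 1) • (T ^ n * D) := by
    have := hpow n
    rw [hT, hMV, add_comm (V * V)] at this
    exact add_left_cancel this
  -- Multiply `V² = (n+1) T^n D` on the left by `T` and cancel `V`, using `T T^n = V`.
  have h2 : T * V = ((n : ℝ) + 1) • D := by
    refine mul_left_cancel_rlOp_one hH ?_
    rw [← hV, ← mul_assoc, ← hTV.eq, mul_assoc, h1, mul_smul_comm, ← mul_assoc, ← pow_succ', hT,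
      mul_smul_comm]
  have h3 := DFunLike.congr_fun h2 (oneLp H p)
  have hM1 : M (oneLp H p) = V (oneLp H p) := mulVar_oneLp
  have h4 : T (V (oneLp H p)) = V (T (oneLp H p)) := DFunLike.congr_fun hTV.eq (oneLp H p)
  simp only [hD, mul_apply_eq_comp, smul_apply, sub_apply, hM1, h4, smul_sub] at h3
  rw [← sub_eq_zero] at h3 ⊢
  rw [← neg_eq_zero, ← h3]
  module

/-- The equation of `mulVar_root_apply_one` reads `x f = c ∫ f` with `c = (n+2)/(n+1)`; the exponent
is `c - 1 = 1/(n+1)`. -/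
theorem exists_root_apply_one (hH : 0 < H) {T : LpIcc p 0 H →L[ℝ] LpIcc p 0 H} {n : ℕ}
    (hT : T ^ (n + 1) = rlOp H p 1) :
    ∃ C : ℝ, T (oneLp H p) =ᵐ[volume.restrict (Icc 0 H)]
      fun t => C * t ^ (((n : ℝ) + 2) / (n + 1) - 1) := by
  refine exists_eq_const_mul_rpow hH (LpIcc.integrableOn _) _ ?_
  have h := mulVar_root_apply_one hH hT
  set a := T (oneLp H p)
  filter_upwards [Lp.coeFn_smul ((n : ℝ) + 1) (mulVar H p a), coeFn_mulVar a,
    Lp.coeFn_smul ((n : ℝ) + 2) (rlOp H p 1 a), coeFn_rlOp_one a] with t h1 h2 h3 h4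
  rw [h, h3, Pi.smul_apply, Pi.smul_apply, h2, h4, smul_eq_mul, smul_eq_mul] at h1
  have : (n : ℝ) + 1 ≠ 0 := by positivity
  rw [div_mul_eq_mul_div, h1]
  field_simp

theorem rlOp_one_ne_zero (hH : 0 < H) : rlOp H p 1 ≠ 0 := fun h =>
  oneLp_ne_zero (p := p) hH (rlOp_one_injective hH (by simp [h]))

/-- Two roots of the same order of the integration operator are proportional. -/
theorem exists_smul_eq_of_pow_eq (hH : 0 < H) {S T : LpIcc p 0 H →L[ℝ] LpIcc p 0 H} {n : ℕ}
    (hT : T ^ (n + 1) = rlOp H p 1) (hS : S ^ (n + 1) = rlOp H p 1) : ∃ r : ℝ, T = r • S := by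
  obtain ⟨C, hC⟩ := exists_root_apply_one hH hT
  obtain ⟨D, hD⟩ := exists_root_apply_one hH hS
  have hTV : Commute T (rlOp H p 1) := hT ▸ Commute.self_pow T (n + 1)
  have hSV : Commute S (rlOp H p 1) := hS ▸ Commute.self_pow S (n + 1)
  have hT' := mul_rlOp_one_of_commute hTV
  have hS' := mul_rlOp_one_of_commute hSV
  -- If `S1 = 0`, then `SV` is convolution by zero, which forces `S = 0` and `V = 0`.
  have hD0 : D ≠ 0 := by
    rintro rfl
    have h0 : (S (oneLp H p)).toOne = 0 := by
      refine Lp.eq_zero_iff_ae_eq_zero.2 ((LpIcc.coeFn_toOne _).trans (hD.trans ?_))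
      exact Filter.Eventually.of_forall fun t => by simp
    rw [h0, map_zero, hSV.eq] at hS'
    have : S = 0 := mul_left_cancel_rlOp_one hH (by rw [hS', mul_zero])
    rw [this, zero_pow n.succ_ne_zero] at hS
    exact rlOp_one_ne_zero hH hS.symm
  refine ⟨C / D, mul_left_cancel_rlOp_one hH ?_⟩
  rw [← hTV.eq, hT', mul_smul_comm, ← hSV.eq, hS', ← map_smul]
  congr 1
  refine Lp.ext ?_
  filter_upwards [LpIcc.coeFn_toOne (T (oneLp H p)), LpIcc.coeFn_toOne (S (oneLp H p)), hC, hD,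
    Lp.coeFn_smul (C / D) (S (oneLp H p)).toOne] with t h1 h2 h3 h4 h5
  rw [h5, Pi.smul_apply, h1, h2, h3, h4, smul_eq_mul]
  field_simp

theorem pow_eq_of_index_law {R : Type*} [Monoid R] {J : {α : ℝ // 0 < α} → R}
    (hJ : ∀ α β, J α * J β = J (α + β)) (α : {α : ℝ // 0 < α}) (n : ℕ) :
    J α ^ (n + 1) = J ⟨(n + 1) * α, mul_pos (by positivity) α.2⟩ := by
  induction n with
  | zero =>
    rw [zero_add, pow_one]
    congr 1
    ext
    simp
  | succ n ih =>
    rw [pow_succ, ih, hJ]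
    congr 1
    ext
    simp only [Positive.coe_add]
    push_cast
    ring

theorem dense_range_posRat :
    Dense {α : {α : ℝ // 0 < α} | ∃ m n : ℕ, (α : ℝ) = (m + 1) / (n + 1)} := by
  have h1 : Dense ((Subtype.val : {α : ℝ // 0 < α} → ℝ) ⁻¹' range ((↑) : ℚ → ℝ)) :=
    Dense.preimage Rat.denseRange_cast (isOpen_Ioi (a := (0 : ℝ))).isOpenMap_subtype_val
  refine h1.mono ?_
  rintro ⟨_, hα⟩ ⟨q, rfl⟩
  have hq : 0 < q := by exact_mod_cast hα
  -- Numerator and denominator are positive, so the truncated subtractions lose nothing.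
  refine ⟨q.num.toNat - 1, q.den - 1, ?_⟩
  have hnum : 0 < q.num := Rat.num_pos.2 hq
  have h2 : ((q.num.toNat - 1 : ℕ) : ℝ) + 1 = q.num := by
    have : ((q.num.toNat - 1 : ℕ) : ℤ) + 1 = q.num := by omega
    exact_mod_cast this
  have h3 : ((q.den - 1 : ℕ) : ℝ) + 1 = q.den := by
    have := q.den_pos
    have : (q.den - 1 : ℕ) + 1 = q.den := by omega
    exact_mod_cast this
  rw [h2, h3]
  exact Rat.cast_def q

/-- A continuous semigroup of operators that interpolates integration consists of the
Riemann–Liouville operators. -/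
theorem eq_rlOp_of_index_law (hH : 0 < H)
    {J : {α : ℝ // 0 < α} → (LpIcc p 0 H →L[ℝ] LpIcc p 0 H)} (h1 : J 1 = rlOp H p 1)
    (hJ : ∀ α β, J α * J β = J (α + β)) (hc : Continuous J) : J = rlOp H p := by
  have hroot : ∀ {K : {α : ℝ // 0 < α} → (LpIcc p 0 H →L[ℝ] LpIcc p 0 H)},
      (∀ α β, K α * K β = K (α + β)) → ∀ n : ℕ,
        K ⟨1 / (n + 1), by positivity⟩ ^ (n + 1) = K 1 := by
    intro K hK n
    rw [pow_eq_of_index_law hK]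
    congr 1
    ext
    have : (n : ℝ) + 1 ≠ 0 := by positivity
    simp [this]
  have hS : ∀ α β, rlOp H p α * rlOp H p β = rlOp H p (α + β) := rlOp_comp
  have hunit : ∀ n : ℕ, J ⟨1 / (n + 1), by positivity⟩ = rlOp H p ⟨1 / (n + 1), by positivity⟩ := by
    intro n
    have hsq : ∀ {K : {α : ℝ // 0 < α} → (LpIcc p 0 H →L[ℝ] LpIcc p 0 H)},
        (∀ α β, K α * K β = K (α + β)) →
        K ⟨1 / ((2 * n + 1 : ℕ) + 1), by positivity⟩ ^ 2 = K ⟨1 / (n + 1), by positivity⟩ := by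
      intro K hK
      rw [pow_eq_of_index_law hK _ 1]
      congr 1
      ext
      push_cast
      field_simp
      ring
    -- Roots of the even order `2n + 2` are compared: the proportionality factor `r` may be `-1`,
    -- but only `r²` enters the operators of order `1/(n+1)`.
    have hJ' := (hroot hJ (2 * n + 1)).trans h1
    have hS' := hroot hS (2 * n + 1)
    obtain ⟨r, hr⟩ := exists_smul_eq_of_pow_eq hH hJ' hS'
    have hr1 : (r ^ 2) ^ (n + 1) = 1 := by
      rw [hr, smul_pow, hS'] at hJ'
      have h2 : (r ^ (2 * n + 1 + 1) - 1) • rlOp H p 1 = 0 := by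
        rw [sub_smul, hJ', one_smul, sub_self]
      have h3 := (smul_eq_zero.1 h2).resolve_right (rlOp_one_ne_zero hH)
      rw [← pow_mul]
      linear_combination h3
    have hr2 : r ^ 2 = 1 := (pow_eq_one_iff_of_nonneg (sq_nonneg r) n.succ_ne_zero).1 hr1
    rw [← hsq hJ, ← hsq hS, hr, smul_pow, hr2, one_smul]
  refine hc.ext_on dense_range_posRat continuous_rlOp ?_
  rintro α ⟨m, n, hα⟩
  have hα' : α = ⟨(m + 1) * (1 / (n + 1)), by positivity⟩ := Subtype.ext (by rw [hα]; ring)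
  rw [hα', ← pow_eq_of_index_law hJ ⟨1 / (n + 1), by positivity⟩ m,
    ← pow_eq_of_index_law hS ⟨1 / (n + 1), by positivity⟩ m, hunit]

end

/-! ### Change of variables between `[a,b]` and `[0,H]` -/

section

/-- A continuous strictly increasing function on `[a,b]` extends, after normalization at `a`, to a
homeomorphism of the line. -/
theorem exists_homeomorph_eqOn_sub {a b : ℝ} (hab : a < b) {h : ℝ → ℝ}
    (hc : ContinuousOn h (Icc a b)) (hm : StrictMonoOn h (Icc a b)) :
    ∃ e : ℝ ≃ₜ ℝ, StrictMono e ∧ ∀ t ∈ Icc a b, e t = h t - h a := by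
  set c : ℝ → ℝ := fun t => max a (min b t) with hcdef
  have hcI : ∀ t, c t ∈ Icc a b := fun t => ⟨le_max_left _ _, max_le hab.le (min_le_left _ _)⟩
  have hcc : Continuous c := by fun_prop
  -- With `c` the projection onto `[a,b]`, this continues `h - h(a)` with slope one outside the
  -- interval.
  set x : ℝ → ℝ := fun t => h (c t) - h a + (t - c t) with hx
  have hxc : Continuous x :=
    ((hc.comp_continuous hcc hcI).sub continuous_const).add (continuous_id.sub hcc)
  have hxm : StrictMono x := by
    intro s t hst
    have h1 : c s ≤ c t := max_le_max le_rfl (min_le_min le_rfl hst.le)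
    have h2 : c t - c s ≤ t - s := by
      simp only [hcdef]
      grind
    rcases h1.eq_or_lt with h3 | h3
    · simp only [hx, h3]
      linarith
    · have := hm (hcI s) (hcI t) h3
      simp only [hx]
      linarith
  have htop : Filter.Tendsto x Filter.atTop Filter.atTop := by
    refine Filter.Tendsto.congr' ?_
      (Filter.tendsto_atTop_add_const_left _ (h b - h a - b) Filter.tendsto_id)
    filter_upwards [Filter.eventually_ge_atTop b] with t ht
    have : c t = b := by simp [hcdef, ht, hab.le]
    simp only [hx, this, id]
    ring
  have hbot : Filter.Tendsto x Filter.atBot Filter.atBot := by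
    refine Filter.Tendsto.congr' ?_
      (Filter.tendsto_atBot_add_const_left _ (-a) Filter.tendsto_id)
    filter_upwards [Filter.eventually_le_atBot a] with t ht
    have : c t = a := by simp [hcdef, ht.trans hab.le, ht]
    simp only [hx, this, id]
    ring
  refine ⟨(hxm.orderIsoOfSurjective x (hxc.surjective htop hbot)).toHomeomorph, hxm, ?_⟩
  intro t ht
  have : c t = t := by simp [hcdef, ht.1, ht.2]
  change x t = _
  simp [hx, this]

variable {p : ENNReal} [Fact (1 ≤ p)]

/-- Composition with a measurable map whose pushforward measure is dominated. -/
def compLp {μ ν : Measure ℝ} {e : ℝ → ℝ} (he : Measurable e) {c : ENNReal} (hc : c ≠ ⊤)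
    (hμ : μ.map e ≤ c • ν) : Lp ℝ p ν →L[ℝ] Lp ℝ p μ :=
  (Lp.compMeasurePreservingₗᵢ ℝ e (⟨he, rfl⟩ : MeasurePreserving e μ
    (μ.map e))).toContinuousLinearMap.comp (Lp.LpToLpOfMeasureLeSMul hc hμ)

theorem coeFn_compLp {μ ν : Measure ℝ} {e : ℝ → ℝ} (he : Measurable e) {c : ENNReal} (hc : c ≠ ⊤)
    (hμ : μ.map e ≤ c • ν) (f : Lp ℝ p ν) : compLp he hc hμ f =ᵐ[μ] f ∘ e := by
  have h1 : MeasurePreserving e μ (μ.map e) := ⟨he, rfl⟩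
  exact (Lp.coeFn_compMeasurePreserving (Lp.LpToLpOfMeasureLeSMul hc hμ f) h1).trans
    (ae_eq_comp he.aemeasurable (Lp.coeFn_LpToLpOfMeasureLeSMul hc hμ f))

/-- A function on `[a,b]` with continuous positive derivative `d`, extended to a homeomorphism of
the line that maps `[a,b]` onto `[0,H]`. -/
structure IsC1Chart (a b H : ℝ) (d : ℝ → ℝ) (e : ℝ ≃ₜ ℝ) : Prop where
  strictMono : StrictMono e
  map_left : e a = 0
  map_right : e b = H
  hasDerivWithinAt : ∀ t ∈ Icc a b, HasDerivWithinAt e (d t) (Icc a b) t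
  continuousOn : ContinuousOn d (Icc a b)
  pos : ∀ t ∈ Icc a b, 0 < d t

namespace IsC1Chart

variable {a b H : ℝ} {d : ℝ → ℝ} {e : ℝ ≃ₜ ℝ}

theorem image_Icc (he : IsC1Chart a b H d e) (t : ℝ) : e '' Icc a t = Icc 0 (e t) := by
  rw [← he.map_left]
  exact (he.strictMono.orderIsoOfSurjective e e.surjective).image_Icc a t

theorem volume_image (he : IsC1Chart a b H d e) {s : Set ℝ} (hs : MeasurableSet s) :
    (volume.restrict (Icc 0 H)) (e '' s) = ∫⁻ t in s, ENNReal.ofReal (d t)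
      ∂(volume.restrict (Icc a b)) := by
  have hm : MeasurableSet (s ∩ Icc a b) := hs.inter measurableSet_Icc
  have h1 := lintegral_image_eq_lintegral_abs_deriv_mul (f := e) (f' := d) hm
    (fun x hx => (he.hasDerivWithinAt x hx.2).mono inter_subset_right)
    e.injective.injOn (fun _ => 1)
  rw [setLIntegral_one, image_inter e.injective, he.image_Icc, he.map_right] at h1
  rw [Measure.restrict_apply' measurableSet_Icc, h1, Measure.restrict_restrict hs]
  refine setLIntegral_congr_fun hm fun x hx => ?_
  rw [mul_one, abs_of_pos (he.pos x hx.2)]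

/-- The density `d` has a positive minimum on the compact interval, and its inverse is the constant.
-/
theorem exists_map_le (he : IsC1Chart a b H d e) (hab : a < b) :
    ∃ c : ENNReal, c ≠ ⊤ ∧ (volume.restrict (Icc a b)).map e ≤ c • volume.restrict (Icc 0 H) := by
  obtain ⟨t₀, ht₀, hmin⟩ := isCompact_Icc.exists_isMinOn (nonempty_Icc.2 hab.le) he.continuousOn
  have hd0 : ENNReal.ofReal (d t₀) ≠ 0 := by simpa using he.pos t₀ ht₀
  refine ⟨(ENNReal.ofReal (d t₀))⁻¹, ENNReal.inv_ne_top.2 hd0, Measure.le_iff.2 fun B hB => ?_⟩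
  have hB' : MeasurableSet (e ⁻¹' B) := e.continuous.measurable hB
  rw [Measure.map_apply e.continuous.measurable hB, Measure.smul_apply, smul_eq_mul,
    ← ENNReal.div_eq_inv_mul, ENNReal.le_div_iff_mul_le (Or.inl hd0) (Or.inl ENNReal.ofReal_ne_top)]
  nth_rewrite 2 [← image_preimage_eq B e.surjective]
  rw [he.volume_image hB', mul_comm, ← setLIntegral_const]
  refine lintegral_mono_ae ?_
  filter_upwards [ae_restrict_of_ae (ae_restrict_mem measurableSet_Icc)] with x hx
  exact ENNReal.ofReal_le_ofReal (hmin hx)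

theorem exists_map_symm_le (he : IsC1Chart a b H d e) (hab : a < b) :
    ∃ c : ENNReal, c ≠ ⊤ ∧
      (volume.restrict (Icc 0 H)).map e.symm ≤ c • volume.restrict (Icc a b) := by
  obtain ⟨t₀, ht₀, hmax⟩ := isCompact_Icc.exists_isMaxOn (nonempty_Icc.2 hab.le) he.continuousOn
  refine ⟨ENNReal.ofReal (d t₀), ENNReal.ofReal_ne_top, Measure.le_iff.2 fun B hB => ?_⟩
  rw [Measure.map_apply e.symm.continuous.measurable hB, Measure.smul_apply, smul_eq_mul,
    ← e.image_eq_preimage_symm, he.volume_image hB, ← setLIntegral_const]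
  refine lintegral_mono_ae ?_
  filter_upwards [ae_restrict_of_ae (ae_restrict_mem measurableSet_Icc)] with x hx
  exact ENNReal.ofReal_le_ofReal (hmax hx)

/-- Change of variables gives an isomorphism of `L^p` spaces. -/
theorem exists_equiv (he : IsC1Chart a b H d e) (hab : a < b) :
    ∃ Φ : LpIcc p 0 H ≃L[ℝ] LpIcc p a b,
      (∀ f, Φ f =ᵐ[volume.restrict (Icc a b)] f ∘ e) ∧
      ∀ f, Φ.symm f =ᵐ[volume.restrict (Icc 0 H)] f ∘ e.symm := by
  obtain ⟨c, hc, hμ⟩ := he.exists_map_le hab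
  obtain ⟨c', hc', hν⟩ := he.exists_map_symm_le hab
  have hm := e.continuous.measurable
  have hm' := e.symm.continuous.measurable
  have hq : Measure.QuasiMeasurePreserving e (volume.restrict (Icc a b))
      (volume.restrict (Icc 0 H)) := ⟨hm, Measure.absolutelyContinuous_of_le_smul hμ⟩
  have hq' : Measure.QuasiMeasurePreserving e.symm (volume.restrict (Icc 0 H))
      (volume.restrict (Icc a b)) := ⟨hm', Measure.absolutelyContinuous_of_le_smul hν⟩
  refine ⟨ContinuousLinearEquiv.equivOfInverse (compLp hm hc hμ) (compLp hm' hc' hν) ?_ ?_,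
    coeFn_compLp hm hc hμ, coeFn_compLp hm' hc' hν⟩
  · intro f
    refine Lp.ext ((coeFn_compLp hm' hc' hν _).trans
      ((hq'.ae_eq_comp (coeFn_compLp hm hc hμ f)).trans ?_))
    exact Filter.Eventually.of_forall fun x => by simp
  · intro f
    refine Lp.ext ((coeFn_compLp hm hc hμ _).trans
      ((hq.ae_eq_comp (coeFn_compLp hm' hc' hν f)).trans ?_))
    exact Filter.Eventually.of_forall fun x => by simp

end IsC1Chart

theorem exists_isC1Chart {a b : ℝ} (hab : a < b) {h : ℝ → ℝ} (hC1 : ContDiffOn ℝ 1 h (Icc a b))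
    (hpos : ∀ t ∈ Icc a b, 0 < derivWithin h (Icc a b) t) :
    ∃ e : ℝ ≃ₜ ℝ, IsC1Chart a b (h b - h a) (derivWithin h (Icc a b)) e ∧
      ∀ t ∈ Icc a b, e t = h t - h a := by
  have hm : StrictMonoOn h (Icc a b) := by
    refine strictMonoOn_of_deriv_pos (convex_Icc a b) hC1.continuousOn fun x hx => ?_
    rw [interior_Icc] at hx
    rw [← derivWithin_of_mem_nhds (Icc_mem_nhds hx.1 hx.2)]
    exact hpos x (Ioo_subset_Icc_self hx)
  obtain ⟨e, hmono, heq⟩ := exists_homeomorph_eqOn_sub hab hC1.continuousOn hm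
  refine ⟨e, ⟨hmono, ?_, heq b (right_mem_Icc.2 hab.le), fun t ht => ?_, ?_, hpos⟩, heq⟩
  · rw [heq a (left_mem_Icc.2 hab.le), sub_self]
  · have h1 := ((hC1.differentiableOn one_ne_zero) t ht).hasDerivWithinAt.sub_const (h a)
    exact h1.congr heq (heq t ht)
  · exact hC1.continuousOn_derivWithin (uniqueDiffOn_Icc hab) le_rfl

/-- The Riemann–Liouville integral with respect to `h` is conjugate, by the change of variables
`x = h(t) - h(a)`, to the classical one. -/
theorem isRiemannLiouville_conj {a b : ℝ} (hab : a < b) {h : ℝ → ℝ} {e : ℝ ≃ₜ ℝ}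
    (he : IsC1Chart a b (h b - h a) (derivWithin h (Icc a b)) e)
    (heq : ∀ t ∈ Icc a b, e t = h t - h a)
    {Φ : LpIcc p 0 (h b - h a) ≃L[ℝ] LpIcc p a b}
    (hΦ : ∀ f, Φ f =ᵐ[volume.restrict (Icc a b)] f ∘ e)
    (hΦ' : ∀ f, Φ.symm f =ᵐ[volume.restrict (Icc 0 (h b - h a))] f ∘ e.symm) :
    IsRiemannLiouville p a b h fun α =>
      (Φ : LpIcc p 0 (h b - h a) →L[ℝ] LpIcc p a b).comp
        ((rlOp (h b - h a) p α).comp (Φ.symm : LpIcc p a b →L[ℝ] LpIcc p 0 (h b - h a))) := by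
  intro α f
  obtain ⟨c, hc, hμ⟩ := he.exists_map_le hab
  have hq : Measure.QuasiMeasurePreserving e (volume.restrict (Icc a b))
      (volume.restrict (Icc 0 (h b - h a))) :=
    ⟨e.continuous.measurable, Measure.absolutelyContinuous_of_le_smul hμ⟩
  filter_upwards [hΦ (rlOp (h b - h a) p α (Φ.symm f)), hq.ae (coeFn_rlOp α (Φ.symm f)),
    ae_restrict_mem measurableSet_Icc] with t h1 h2 ht
  have het : e t ∈ Icc 0 (h b - h a) := by
    rw [← he.map_left, ← he.map_right]
    exact ⟨he.strictMono.monotone ht.1, he.strictMono.monotone ht.2⟩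
  have hsub : Icc a t ⊆ Icc a b := Icc_subset_Icc_right ht.2
  have hderiv : ∀ x ∈ Icc a t, HasDerivWithinAt e (derivWithin h (Icc a b) x) (Icc a t) x :=
    fun x hx => (he.hasDerivWithinAt x (hsub hx)).mono hsub
  have hae : (fun y => rlKernel α (e t - y) * Φ.symm f y) =ᵐ[volume.restrict (Icc 0 (e t))]
      fun y => rlKernel α (e t - y) * f (e.symm y) := by
    filter_upwards [ae_restrict_of_ae_restrict_of_subset (Icc_subset_Icc_right het.2) (hΦ' f)]
      with y hy
    rw [hy, Function.comp_apply]
  -- The substitution `y = e(s)` turns `dy` into `h'(s) ds`, and `e(t) - e(s) = h(t) - h(s)` because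
  -- `h(a)` cancels.
  have hfun : EqOn (fun s => |derivWithin h (Icc a b) s| • (rlKernel α (e t - e s) *
      f (e.symm (e s)))) (rlIntegrand h a b α f t) (Icc a t) := by
    intro s hs
    simp only [e.symm_apply_apply]
    simp only [rlIntegrand, rlKernel, smul_eq_mul, heq t ht, heq s (hsub hs),
      sub_sub_sub_cancel_right, abs_of_pos (he.pos s (hsub hs))]
    ring
  constructor
  · rw [intervalIntegrable_iff_integrableOn_Icc_of_le ht.1, ← integrableOn_congr_fun hfun
      measurableSet_Icc, ← integrableOn_image_iff_integrableOn_abs_deriv_smul measurableSet_Icc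
      hderiv e.injective.injOn (fun y => rlKernel α (e t - y) * f (e.symm y)), he.image_Icc]
    exact ((intervalIntegrable_iff_integrableOn_Icc_of_le het.1).1 h2.1).congr hae
  · simp only [ContinuousLinearMap.comp_apply, ContinuousLinearEquiv.coe_coe]
    rw [h1, Function.comp_apply, h2.2, rlIntegral, intervalIntegral.integral_of_le het.1,
      intervalIntegral.integral_of_le ht.1, ← integral_Icc_eq_integral_Ioc,
      ← integral_Icc_eq_integral_Ioc, integral_congr_ae hae, ← he.image_Icc,
      integral_image_eq_integral_abs_deriv_smul measurableSet_Icc hderiv e.injective.injOn]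
    exact setIntegral_congr_fun measurableSet_Icc hfun

end

end

/-! ### Transfer of existence and uniqueness to `[a,b]` -/

theorem mainTheorem1 (p : ENNReal) [Fact (1 ≤ p)] (a b : ℝ) (hab : a < b) (h : ℝ → ℝ)
    (hC1 : ContDiffOn ℝ 1 h (Icc a b))
    (hpos : ∀ t ∈ Icc a b, 0 < derivWithin h (Icc a b) t) :
    (∃! J : {α : ℝ // 0 < α} → (LpIcc p a b →L[ℝ] LpIcc p a b),
      IsStieltjesExtension p a b h J) ∧
    ∀ J : {α : ℝ // 0 < α} → (LpIcc p a b →L[ℝ] LpIcc p a b),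
      IsStieltjesExtension p a b h J ↔ IsRiemannLiouville p a b h J := by
  obtain ⟨e, he, heq⟩ := exists_isC1Chart hab hC1 hpos
  obtain ⟨Φ, hΦ, hΦ'⟩ := he.exists_equiv (p := p) hab
  have hH : 0 < h b - h a := by
    rw [← he.map_left, ← he.map_right]
    exact he.strictMono hab
  have hRL := isRiemannLiouville_conj hab he heq hΦ hΦ'
  set S : {α : ℝ // 0 < α} → (LpIcc p a b →L[ℝ] LpIcc p a b) := fun α =>
      (Φ : LpIcc p 0 (h b - h a) →L[ℝ] LpIcc p a b).comp
        ((rlOp (h b - h a) p α).comp (Φ.symm : LpIcc p a b →L[ℝ] LpIcc p 0 (h b - h a))) with hS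
  have hSext : IsStieltjesExtension p a b h S := by
    refine ⟨fun f => ?_, fun α β => ?_, ?_⟩
    · filter_upwards [hRL 1 f] with t ht
      rw [ht.2, ← rlIntegral_one]
      rfl
    · ext1 f
      simp [hS, ← rlOp_comp]
    · exact continuous_const.clm_comp (continuous_rlOp.clm_comp continuous_const)
  have hRLuniq : ∀ J, IsRiemannLiouville p a b h J → J = S := by
    intro J hJ
    funext α
    ext1 f
    refine Lp.ext ?_
    filter_upwards [hJ α f, hRL α f] with t h1 h2
    rw [h1.2, h2.2]
  have hExtUniq : ∀ J, IsStieltjesExtension p a b h J → J = S := by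
    intro J hJ
    have hJ1 : J 1 = S 1 := by
      ext1 f
      refine Lp.ext ?_
      filter_upwards [hJ.interpolation f, hSext.interpolation f] with t h1 h2
      rw [h1, h2]
    -- Conjugating by `Φ` carries `J` to a continuous semigroup on `L^p[0,H]` whose value at 1 is
    -- `V`.
    have key := eq_rlOp_of_index_law hH (J := fun α =>
      (Φ.symm : LpIcc p a b →L[ℝ] LpIcc p 0 (h b - h a)).comp
        ((J α).comp (Φ : LpIcc p 0 (h b - h a) →L[ℝ] LpIcc p a b)))
      (by
        simp only [hJ1, hS]
        ext1 f
        simp)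
      (fun α β => by
        ext1 f
        simp [← hJ.index_law])
      (continuous_const.clm_comp (hJ.continuity.clm_comp continuous_const))
    funext α
    ext1 f
    simp [hS, ← key]
  refine ⟨⟨S, hSext, hExtUniq⟩, fun J => ⟨fun hJ => ?_, fun hJ => ?_⟩⟩
  · rw [hExtUniq J hJ]
    exact hRL
  · rw [hRLuniq J hJ]
    exact hSext
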